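/- Let $0\le m\le n$ be integers, let $p,q>1$ with $\frac1p+\frac1q=1$, let $U\subset\mathbb R^{n-m}$ and $V\subset\mathbb R^m$ be domains (non-empty, open, connected), and let $f:U\times V\to\Omega\subset\mathbb R^n$ be a $C^1$ diffeomorphism onto an open set $\Omega$. Let $|J_f|$ be the absolute value of the Jacobian determinant of $f$, and for fixed $x$ let $|J^y_f|=\sqrt{\det(T^{\top}T)}$, where $T=D_yf(x,y)$ is the differential at $y$ of $V\ni y\mapsto f(x,y)$ (that is, the square root of the sum of the squares of the $m\times m$ minors of $T$). For $x\in U$ put $$l(x)=\int_V\left(\frac{|J^y_f|}{|J_f|}\right)^{q}|J_f|\,dy\in(0,\infty].$$ Let $\Sigma$ be the family of the surfaces $\sigma_x=f(\{x\}\times V)$, $x\in U$, each identified with the $m$-dimensional Hausdorff measure $H^m$ on it (normalized to be Lebesgue measure on $\mathbb R^m$). A Borel function $h:\Omega\to[0,\infty]$ is admissible for a family of measures on $\Omega$ if $\int h\,d\mu\ge1$ for all $\mu$ in the family; the $p$-modulus $\mathrm{mod}_p$ of the family is the infimum of $\int_\Omega h^p\,dz$ over the admissible $h$; an admissible $h$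 is extremal if $\int_\Omega h^p\,dz$ equals the modulus. Define, with $\frac1\infty=0$, $$f_\Sigma(z)=\frac1{l(x)}\left(\frac{|J^y_f|}{|J_f|}\right)^{q-1}(x,y),\qquad z=f(x,y)\in\Omega.$$ Then: 1. $\mathrm{mod}_p(\Sigma)=\int_U l(x)^{1-p}\,dx$ (where $\infty^{1-p}=0$, and both sides may be infinite). 2. If $l(x)<\infty$ for every $x\in U$, then $f_\Sigma$ is extremal for the $p$-modulus of $\Sigma$. In general, $\int_\Omega f_\Sigma^p\,dz=\mathrm{mod}_p(\Sigma)$, $f_\Sigma$ is admissible for the subfamily of those $\sigma_x$ with $l(x)<\infty$, and the remaining subfamily $\{\sigma_x:\ l(x)=\infty\}$ has $p$-modulus zero. 3. If $\mathrm{mod}_p(\Sigma)<\infty$, then every extremal function for $\Sigma$ equals $f_\Sigma$ almost everywhere in $\Omega$. -/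

import Mathlib

open MeasureTheory Set
open scoped ENNReal

noncomputable section

namespace FugledeModulus

section Modulus

variable {X : Type*} [MeasurableSpace X]

/-- A function `f ≥ 0` is admissible for a family `S` of measures on `X` if it is measurable and
`∫ f dμ ≥ 1` for every `μ ∈ S`. -/
def IsAdmissible (S : Set (Measure X)) (f : X → ℝ≥0∞) : Prop :=
  Measurable f ∧ ∀ μ ∈ S, 1 ≤ ∫⁻ z, f z ∂μ

/-- The Fuglede `p`-modulus of `S` with respect to the reference measure `𝔪`: the infimum of
`∫ f ^ p d𝔪` over all admissible `f` (it is `∞` if there is no admissible function). -/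
def modulus (p : ℝ) (𝔪 : Measure X) (S : Set (Measure X)) : ℝ≥0∞ :=
  ⨅ (f : X → ℝ≥0∞) (_ : IsAdmissible S f), ∫⁻ z, f z ^ p ∂𝔪

/-- An extremal function: an admissible function that realizes the modulus. -/
def IsExtremal (p : ℝ) (𝔪 : Measure X) (S : Set (Measure X)) (f : X → ℝ≥0∞) : Prop :=
  IsAdmissible S f ∧ modulus p 𝔪 S = ∫⁻ z, f z ^ p ∂𝔪

end Modulus

section Surfaces

variable {k m n : ℕ}

/-- The family of the `m`-dimensional surfaces `σ_x = f (x, V)`, `x ∈ A`, each identified with the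
`m`-dimensional Hausdorff measure on it (normalized, as usual in Euclidean spaces, so that it
agrees with Lebesgue measure on `ℝ^m`). -/
def surfaceFamily
    (f : EuclideanSpace ℝ (Fin k) × EuclideanSpace ℝ (Fin m) → EuclideanSpace ℝ (Fin n))
    (A : Set (EuclideanSpace ℝ (Fin k))) (V : Set (EuclideanSpace ℝ (Fin m))) :
    Set (Measure (EuclideanSpace ℝ (Fin n))) :=
  (fun x => (Measure.euclideanHausdorffMeasure m).restrict ((fun y => f (x, y)) '' V)) '' A

/-- The jacobian `|J_f|` of `f` at `(x, y)`, i.e. the absolute value of the determinant of the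
matrix of the differential of `f` in the standard bases. Here `LinearMap.normDet T` is the
jacobian `√(det (Tᵀ T))` with respect to Euclidean structures, and the domain `ℝ^k × ℝ^m` carries
the Euclidean structure of `ℝ^(k + m)`. -/
def jac (f : EuclideanSpace ℝ (Fin k) × EuclideanSpace ℝ (Fin m) → EuclideanSpace ℝ (Fin n))
    (x : EuclideanSpace ℝ (Fin k)) (y : EuclideanSpace ℝ (Fin m)) : ℝ :=
  LinearMap.normDet
    ((fderiv ℝ f (x, y) ∘L
      (WithLp.prodContinuousLinearEquiv 2 ℝ (EuclideanSpace ℝ (Fin k))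
        (EuclideanSpace ℝ (Fin m))).toContinuousLinearMap).toLinearMap)

/-- The jacobian `|J^y_f|` at `(x, y)`: the jacobian `√(det (Tᵀ T))` of the differential `T` at `y`
of the map `y' ↦ f (x, y')` with `x` fixed; equivalently the square root of the sum of the squares
of all `m × m` minors of `T`. -/
def jacY (f : EuclideanSpace ℝ (Fin k) × EuclideanSpace ℝ (Fin m) → EuclideanSpace ℝ (Fin n))
    (x : EuclideanSpace ℝ (Fin k)) (y : EuclideanSpace ℝ (Fin m)) : ℝ :=
  LinearMap.normDet (fderiv ℝ (fun y' => f (x, y')) y).toLinearMap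

/-- `l(x) = ∫_V (|J^y_f| / |J_f|) ^ q |J_f| dy`, with values in `[0, ∞]`. -/
def ell (f : EuclideanSpace ℝ (Fin k) × EuclideanSpace ℝ (Fin m) → EuclideanSpace ℝ (Fin n))
    (V : Set (EuclideanSpace ℝ (Fin m))) (q : ℝ) (x : EuclideanSpace ℝ (Fin k)) : ℝ≥0∞ :=
  ∫⁻ y in V, ENNReal.ofReal ((jacY f x y / jac f x y) ^ q * jac f x y)

/-- `f_Σ(z) = l(x)⁻¹ (|J^y_f| / |J_f|) ^ (q - 1)`, `(x, y) = f⁻¹(z)`, for `z ∈ Ω = f (U × V)`,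
extended by `0` outside `Ω` (with `l(x)⁻¹ = 0` where `l(x) = ∞`). -/
def extremalFun
    (f : OpenPartialHomeomorph (EuclideanSpace ℝ (Fin k) × EuclideanSpace ℝ (Fin m))
      (EuclideanSpace ℝ (Fin n)))
    (V : Set (EuclideanSpace ℝ (Fin m))) (q : ℝ) : EuclideanSpace ℝ (Fin n) → ℝ≥0∞ :=
  f.target.indicator fun z =>
    (ell f V q (f.symm z).1)⁻¹ *
      ENNReal.ofReal
        ((jacY f (f.symm z).1 (f.symm z).2 / jac f (f.symm z).1 (f.symm z).2) ^ (q - 1))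

end Surfaces

end FugledeModulus

end

/-! In the coordinates (x, y), change of variables gives dz = |J_f| dx dy, and the area formula
gives dH^m = |J^y_f| dy on σ_x. Put w = |J^y_f| / |J_f| and ν_x = |J_f| dy. Admissibility of h says
that ∫ h w dν_x ≥ 1 for each x, and the energy of h is ∫_U (∫ h^p dν_x) dx, so the problem decouples
into one extremal problem per fiber. Hölder gives ∫ h^p dν_x ≥ l(x)^(1-p)
(`rpow_le_lintegral_rpow`), with equality for h = w^(q-1) / l(x). Integration in x bounds the
modulus from below, and f_Σ has exactly this energy.

On fibers with l(x) = ∞ the function f_Σ vanishes, so it is not admissible there. Truncating w^q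
|J_f| yields functions that satisfy the constraint with fiber energy l_k(x)^(1-p) → 0, and a
measurable choice of k = k(x) makes the total energy at most ε
(`exists_lintegral_rpow_le_of_eq_top`). The maximum of f_Σ and such a function gives the upper
bound, even if these x form a set of positive measure.

If the modulus is finite, an extremal function must attain the fiber bound for almost every x, and
strict convexity of t^p determines it there (`ae_eq_of_lintegral_rpow_eq`).

The fiber argument is run for abstract measures satisfying `IsFibered`; the geometry enters only
through `exists_isFibered`. -/

namespace FugledeModulus

open Filter Topology Module
open scoped NNReal

/-! ### Area formula for injective C¹ immersions, by local comparison with the derivative. -/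

section AreaFormula

/-- No injectivity of `b` is needed: points with equal `b` have equal `a` by the hypothesis, so `a`
factors through `b` on `A` by a `K`-Lipschitz map. -/
theorem hausdorffMeasure_image_le_of_edist_le {X Y Z : Type*} [EMetricSpace Y] [MeasurableSpace Y]
    [BorelSpace Y] [EMetricSpace Z] [MeasurableSpace Z] [BorelSpace Z] {a : X → Y} {b : X → Z}
    {A : Set X} {K : ℝ≥0} {d : ℝ} (hd : 0 ≤ d)
    (h : ∀ x ∈ A, ∀ y ∈ A, edist (a x) (a y) ≤ K * edist (b x) (b y)) :
    Measure.hausdorffMeasure d (a '' A) ≤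
      (K : ℝ≥0∞) ^ d * Measure.hausdorffMeasure d (b '' A) := by
  rcases A.eq_empty_or_nonempty with rfl | ⟨x₀, hx₀⟩
  · simp
  have : Nonempty X := ⟨x₀⟩
  have hinv : ∀ x ∈ A, Function.invFunOn b A (b x) ∈ A := fun x hx =>
    Function.invFunOn_mem ⟨x, hx, rfl⟩
  have hinv' : ∀ x ∈ A, b (Function.invFunOn b A (b x)) = b x := fun x hx =>
    Function.invFunOn_eq ⟨x, hx, rfl⟩
  have hL : LipschitzOnWith K (a ∘ Function.invFunOn b A) (b '' A) := by
    rintro _ ⟨x, hx, rfl⟩ _ ⟨y, hy, rfl⟩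
    simpa [hinv' x hx, hinv' y hy] using h _ (hinv x hx) _ (hinv y hy)
  refine le_trans (measure_mono ?_) (hL.hausdorffMeasure_image_le hd)
  rintro _ ⟨x, hx, rfl⟩
  refine ⟨b x, ⟨x, hx, rfl⟩, ?_⟩
  have := h _ (hinv x hx) _ hx
  rw [hinv' x hx, edist_self, mul_zero] at this
  exact edist_eq_zero.1 (le_antisymm this bot_le)

theorem euclideanHausdorffMeasure_image_le_of_edist_le {X Y Z : Type*} [EMetricSpace Y]
    [MeasurableSpace Y] [BorelSpace Y] [EMetricSpace Z] [MeasurableSpace Z] [BorelSpace Z]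
    {a : X → Y} {b : X → Z} {A : Set X} {K : ℝ≥0} {d : ℕ}
    (h : ∀ x ∈ A, ∀ y ∈ A, edist (a x) (a y) ≤ K * edist (b x) (b y)) :
    Measure.euclideanHausdorffMeasure d (a '' A) ≤
      (K : ℝ≥0∞) ^ d * Measure.euclideanHausdorffMeasure d (b '' A) := by
  have := hausdorffMeasure_image_le_of_edist_le (d := d) d.cast_nonneg h
  rw [ENNReal.rpow_natCast] at this
  simp only [Measure.euclideanHausdorffMeasure_def, Measure.smul_apply, ENNReal.smul_def,
    smul_eq_mul]
  rw [mul_left_comm]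
  gcongr

variable {E F : Type*} [NormedAddCommGroup E] [InnerProductSpace ℝ E] [FiniteDimensional ℝ E]
  [NormedAddCommGroup F] [InnerProductSpace ℝ F]

theorem normDet_pos {T : E →ₗ[ℝ] F} (hT : Function.Injective T) : 0 < T.normDet :=
  lt_of_le_of_ne T.normDet_nonneg (Ne.symm (((T.normDet_ne_zero_tfae).out 0 4).2 hT))

/-- A strictly differentiable map is close to its injective derivative, up to a factor. -/
theorem exists_nhds_edist_le_of_hasStrictFDerivAt {φ : E → F} {T : E →L[ℝ] F} {y₀ : E}
    (hφ : HasStrictFDerivAt φ T y₀) (hT : Function.Injective T) {K : ℝ≥0} (hK : 1 < K) :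
    ∃ N ∈ 𝓝 y₀, ∀ x ∈ N, ∀ y ∈ N, edist (φ x) (φ y) ≤ K * edist (T x) (T y) ∧
      edist (T x) (T y) ≤ K * edist (φ x) (φ y) := by
  obtain ⟨C, hC, hTC⟩ := T.toLinearMap.injective_iff_antilipschitz.1 hT
  have hKi : K⁻¹ < 1 := inv_lt_one_of_one_lt₀ hK
  have hK0 : 0 < K := zero_lt_one.trans hK
  -- Since ‖v‖ ≤ C ‖T v‖, this makes the linearization error at most (1 - 1/K) ‖T v‖, an error
  -- relative to T itself.
  set δ : ℝ≥0 := (1 - K⁻¹) / C with hδ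
  have hδ0 : 0 < δ := div_pos (tsub_pos_of_lt hKi) hC
  obtain ⟨N, hN, hap⟩ := hφ.approximates_deriv_on_nhds (Or.inr hδ0)
  refine ⟨N, hN, fun x hx y hy => ?_⟩
  have h1 : ‖φ x - φ y - T (x - y)‖ ≤ δ * ‖x - y‖ := hap x hx y hy
  have h2 : ‖x - y‖ ≤ C * ‖T (x - y)‖ := by
    simpa [dist_eq_norm] using hTC.le_mul_dist x y
  have h3 : ‖φ x - φ y - T (x - y)‖ ≤ (1 - (K : ℝ)⁻¹) * ‖T (x - y)‖ := by
    refine h1.trans ((mul_le_mul_of_nonneg_left h2 δ.coe_nonneg).trans (le_of_eq ?_))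
    rw [hδ, NNReal.coe_div, NNReal.coe_sub hKi.le]
    have : (C : ℝ) ≠ 0 := by exact_mod_cast hC.ne'
    push_cast
    field_simp
  have hKr : (1 : ℝ) < K := by exact_mod_cast hK
  have hKK : (K : ℝ)⁻¹ * K = 1 := inv_mul_cancel₀ (by positivity)
  have hKn : 0 < (K : ℝ)⁻¹ := by positivity
  have h4 : ‖φ x - φ y‖ ≤ K * ‖T x - T y‖ := by
    rw [← map_sub]
    have h0 := norm_nonneg (T (x - y))
    have : ‖φ x - φ y‖ ≤ ‖T (x - y)‖ + ‖φ x - φ y - T (x - y)‖ := by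
      simpa using norm_add_le (T (x - y)) (φ x - φ y - T (x - y))
    -- The factor obtained is 2 - 1/K, and 2 - 1/K ≤ K amounts to (K - 1)² ≥ 0.
    nlinarith [sq_nonneg ((K : ℝ) - 1)]
  have h5 : ‖T x - T y‖ ≤ K * ‖φ x - φ y‖ := by
    rw [← map_sub]
    have h0 := norm_nonneg (T (x - y))
    have : ‖T (x - y)‖ ≤ ‖φ x - φ y‖ + ‖φ x - φ y - T (x - y)‖ := by
      simpa using norm_sub_le (φ x - φ y) (φ x - φ y - T (x - y))
    have h6 : (K : ℝ)⁻¹ * ‖T (x - y)‖ ≤ ‖φ x - φ y‖ := by linarith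
    calc ‖T (x - y)‖ = K * ((K : ℝ)⁻¹ * ‖T (x - y)‖) := by
          rw [← mul_assoc, mul_comm (K : ℝ), hKK, one_mul]
      _ ≤ _ := by gcongr
  simp only [edist_eq_enorm_sub, enorm_eq_nnnorm]
  exact ⟨by exact_mod_cast h4, by exact_mod_cast h5⟩

variable [FiniteDimensional ℝ F]

theorem continuous_normDet : Continuous fun T : E →L[ℝ] F => T.toLinearMap.normDet := by
  have : CompleteSpace E := FiniteDimensional.complete ℝ E
  have : CompleteSpace F := FiniteDimensional.complete ℝ F
  have h : (fun T : E →L[ℝ] F => T.toLinearMap.normDet) =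
      fun T => Real.sqrt (ContinuousLinearMap.adjoint T ∘L T).det := by
    ext T
    rw [← ContinuousLinearMap.normDet_sq]
    simp [Real.sqrt_sq T.toLinearMap.normDet_nonneg]
  rw [h]
  refine Real.continuous_sqrt.comp (ContinuousLinearMap.continuous_det.comp ?_)
  exact (ContinuousLinearMap.adjoint (𝕜 := ℝ) (E := E) (F := F)).continuous.clm_comp continuous_id

variable [MeasurableSpace E] [BorelSpace E] [MeasurableSpace F] [BorelSpace F]

/-- Near `y₀`, replacing φ by its derivative T costs a factor K^d in the measure of images, and
freezing the jacobian at `y₀` costs a factor K. For T itself the formula is exact, so K^d * K < c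
suffices. The bounds hold for all measurable subsets of one neighbourhood, so they can be summed
over a partition. -/
theorem exists_nhds_euclideanHausdorffMeasure_image_le {φ : E → F} {y₀ : E}
    (hφ : ContDiffAt ℝ 1 φ y₀) (hT : Function.Injective (fderiv ℝ φ y₀))
    {c : ℝ≥0} (hc : 1 < c) :
    ∃ N ∈ 𝓝 y₀, ∀ A ⊆ N, MeasurableSet A →
      Measure.euclideanHausdorffMeasure (finrank ℝ E) (φ '' A) ≤
        c * ∫⁻ y in A, ENNReal.ofReal (fderiv ℝ φ y).toLinearMap.normDet ∧
      ∫⁻ y in A, ENNReal.ofReal (fderiv ℝ φ y).toLinearMap.normDet ≤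
        c * Measure.euclideanHausdorffMeasure (finrank ℝ E) (φ '' A) := by
  set d := finrank ℝ E
  obtain ⟨K, hK1, hKc⟩ : ∃ K : ℝ≥0, 1 < K ∧ K ^ d * K < c := by
    have hcont : Tendsto (fun K : ℝ≥0 => K ^ d * K) (𝓝[>] 1) (𝓝 1) := by
      have : Continuous fun K : ℝ≥0 => K ^ d * K := by fun_prop
      simpa using (this.tendsto 1).mono_left nhdsWithin_le_nhds
    obtain ⟨K, h1, h2⟩ := ((hcont.eventually_lt_const hc).and self_mem_nhdsWithin).exists
    exact ⟨K, h2, h1⟩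
  have hK0 : (0 : ℝ≥0) < K := zero_lt_one.trans hK1
  set T := fderiv ℝ φ y₀
  obtain ⟨N, hN, hNT⟩ := exists_nhds_edist_le_of_hasStrictFDerivAt
    (hφ.hasStrictFDerivAt one_ne_zero) hT hK1
  have hJ0 : 0 < T.toLinearMap.normDet := normDet_pos hT
  have hJc : ContinuousAt (fun y => (fderiv ℝ φ y).toLinearMap.normDet) y₀ :=
    continuous_normDet.continuousAt.comp (hφ.continuousAt_fderiv one_ne_zero)
  have hKr : (1 : ℝ) < K := by exact_mod_cast hK1
  have hJ1 : ∀ᶠ y in 𝓝 y₀, (fderiv ℝ φ y).toLinearMap.normDet < K * T.toLinearMap.normDet :=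
    hJc.eventually_lt_const (by nlinarith)
  have hJ2 : ∀ᶠ y in 𝓝 y₀, T.toLinearMap.normDet < K * (fderiv ℝ φ y).toLinearMap.normDet :=
    (hJc.const_mul (K : ℝ)).eventually_const_lt (by nlinarith)
  refine ⟨N ∩ {y | (fderiv ℝ φ y).toLinearMap.normDet < K * T.toLinearMap.normDet ∧
    T.toLinearMap.normDet < K * (fderiv ℝ φ y).toLinearMap.normDet},
    inter_mem hN (hJ1.and hJ2), fun A hA hAm => ?_⟩
  have hTA : Measure.euclideanHausdorffMeasure d (T '' A) =
      ENNReal.ofReal T.toLinearMap.normDet * volume A :=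
    T.toLinearMap.euclideanHausdorffMeasure_image_eq_normDet_mul_volume A
  have hle1 : ENNReal.ofReal T.toLinearMap.normDet * volume A ≤
      K * ∫⁻ y in A, ENNReal.ofReal (fderiv ℝ φ y).toLinearMap.normDet := by
    rw [← setLIntegral_const, ← lintegral_const_mul' _ _ ENNReal.coe_ne_top]
    refine setLIntegral_mono' hAm fun y hy => ?_
    rw [← ENNReal.ofReal_coe_nnreal, ← ENNReal.ofReal_mul K.coe_nonneg]
    exact ENNReal.ofReal_le_ofReal (hA hy).2.2.le
  have hle2 : ∫⁻ y in A, ENNReal.ofReal (fderiv ℝ φ y).toLinearMap.normDet ≤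
      K * (ENNReal.ofReal T.toLinearMap.normDet * volume A) := by
    rw [← mul_assoc, ← setLIntegral_const]
    refine setLIntegral_mono' hAm fun y hy => ?_
    rw [← ENNReal.ofReal_coe_nnreal, ← ENNReal.ofReal_mul K.coe_nonneg]
    exact ENNReal.ofReal_le_ofReal (hA hy).2.1.le
  have hKc' : (K : ℝ≥0∞) ^ d * K ≤ c := by exact_mod_cast hKc.le
  constructor
  · refine (euclideanHausdorffMeasure_image_le_of_edist_le (b := T) (K := K) fun x hx y hy =>
      (hNT x (hA hx).1 y (hA hy).1).1).trans ?_
    rw [hTA]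
    refine le_trans ?_ (mul_le_mul_left hKc' _)
    rw [mul_assoc]
    gcongr
  · refine hle2.trans ?_
    rw [← hTA]
    refine le_trans (mul_le_mul_right (euclideanHausdorffMeasure_image_le_of_edist_le (b := φ)
      (K := K) fun x hx y hy => (hNT x (hA hx).1 y (hA hy).1).2) _) ?_
    rw [← mul_assoc, mul_comm (K : ℝ≥0∞)]
    gcongr

/-- The area formula for the image of a measurable set under an injective `C¹` immersion. -/
theorem euclideanHausdorffMeasure_image_eq_lintegral {φ : E → F} {s A : Set E}
    (hφ : ∀ y ∈ s, ContDiffAt ℝ 1 φ y) (hinj : InjOn φ s)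
    (hT : ∀ y ∈ s, Function.Injective (fderiv ℝ φ y)) (hAs : A ⊆ s) (hA : MeasurableSet A) :
    Measure.euclideanHausdorffMeasure (finrank ℝ E) (φ '' A) =
      ∫⁻ y in A, ENNReal.ofReal (fderiv ℝ φ y).toLinearMap.normDet := by
  set d := finrank ℝ E
  have key : ∀ c : ℝ≥0, 1 < c →
      Measure.euclideanHausdorffMeasure d (φ '' A) ≤
        c * ∫⁻ y in A, ENNReal.ofReal (fderiv ℝ φ y).toLinearMap.normDet ∧
      ∫⁻ y in A, ENNReal.ofReal (fderiv ℝ φ y).toLinearMap.normDet ≤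
        c * Measure.euclideanHausdorffMeasure d (φ '' A) := by
    intro c hc
    rcases A.eq_empty_or_nonempty with rfl | hAne
    · simp
    choose! N hN hNle using fun y (hy : y ∈ A) =>
      exists_nhds_euclideanHausdorffMeasure_image_le (hφ y (hAs hy)) (hT y (hAs hy)) hc
    obtain ⟨t, htA, htc, htU⟩ := TopologicalSpace.countable_cover_nhdsWithin
      (f := fun y => interior (N y)) (s := A)
      fun y hy => mem_nhdsWithin_of_mem_nhds (interior_mem_nhds.2 (hN y hy))
    have htne : t.Nonempty := by
      obtain ⟨y, hy⟩ := hAne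
      obtain ⟨i, hi, -⟩ := mem_iUnion₂.1 (htU hy)
      exact ⟨i, hi⟩
    obtain ⟨u, rfl⟩ := htc.exists_eq_range htne
    -- Countably many of the neighbourhoods cover `A`; made disjoint, they allow both sides to be
    -- summed with the same constant `c`.
    set D : ℕ → Set E := disjointed fun i => interior (N (u i))
    have hDm : ∀ i, MeasurableSet (D i) := fun i =>
      MeasurableSet.disjointed (fun i => isOpen_interior.measurableSet) i
    have hDd : Pairwise (Function.onFun Disjoint fun i => A ∩ D i) := fun i j hij =>
      (disjoint_disjointed _ hij).mono inter_subset_right inter_subset_right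
    have hAD : A = ⋃ i, A ∩ D i := by
      rw [← inter_iUnion, iUnion_disjointed, eq_comm, inter_eq_left]
      simpa using htU
    have hint : ∫⁻ y in A, ENNReal.ofReal (fderiv ℝ φ y).toLinearMap.normDet =
        ∑' i, ∫⁻ y in A ∩ D i, ENNReal.ofReal (fderiv ℝ φ y).toLinearMap.normDet := by
      conv_lhs => rw [hAD]
      exact lintegral_iUnion (fun i => hA.inter (hDm i)) hDd _
    have hmeas : Measure.euclideanHausdorffMeasure d (φ '' A) =
        ∑' i, Measure.euclideanHausdorffMeasure d (φ '' (A ∩ D i)) := by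
      conv_lhs => rw [hAD, image_iUnion]
      refine measure_iUnion (fun i j hij => ?_) fun i => ?_
      · refine disjoint_left.2 ?_
        rintro _ ⟨x, hx, rfl⟩ ⟨y, hy, hxy⟩
        obtain rfl := hinj (hAs hy.1) (hAs hx.1) hxy
        exact disjoint_left.1 (hDd hij) hx hy
      · exact (hA.inter (hDm i)).image_of_continuousOn_injOn
          (fun y hy => (hφ y (hAs hy.1)).continuousAt.continuousWithinAt)
          (hinj.mono (inter_subset_left.trans hAs))
    have hsub : ∀ i, A ∩ D i ⊆ N (u i) := fun i => inter_subset_right.trans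
      ((disjointed_subset _ i).trans interior_subset)
    rw [hint, hmeas, ← ENNReal.tsum_mul_left, ← ENNReal.tsum_mul_left]
    exact ⟨ENNReal.tsum_le_tsum fun i =>
        (hNle _ (htA (mem_range_self i)) _ (hsub i) (hA.inter (hDm i))).1,
      ENNReal.tsum_le_tsum fun i =>
        (hNle _ (htA (mem_range_self i)) _ (hsub i) (hA.inter (hDm i))).2⟩
  have lim : ∀ a b : ℝ≥0∞, (∀ c : ℝ≥0, 1 < c → a ≤ c * b) → a ≤ b := by
    intro a b h
    rcases eq_or_ne b ∞ with rfl | hb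
    · exact le_top
    have : Tendsto (fun c : ℝ≥0 => (c : ℝ≥0∞) * b) (𝓝[>] 1) (𝓝 b) := by
      have h1 : Tendsto (fun c : ℝ≥0 => (c : ℝ≥0∞)) (𝓝[>] 1) (𝓝 ((1 : ℝ≥0) : ℝ≥0∞)) :=
        (ENNReal.continuous_coe.tendsto 1).mono_left nhdsWithin_le_nhds
      simpa using ENNReal.Tendsto.mul_const h1 (Or.inr hb)
    exact ge_of_tendsto this (eventually_mem_of_tendsto_nhdsWithin tendsto_id |>.mono h)
  exact le_antisymm (lim _ _ fun c hc => (key c hc).1) (lim _ _ fun c hc => (key c hc).2)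

/-- The area formula for an injective `C¹` immersion of an open set. -/
theorem setLIntegral_image_euclideanHausdorffMeasure {φ : E → F} {s : Set E} (hs : IsOpen s)
    (hφ : ∀ y ∈ s, ContDiffAt ℝ 1 φ y) (hinj : InjOn φ s)
    (hT : ∀ y ∈ s, Function.Injective (fderiv ℝ φ y)) {h : F → ℝ≥0∞} (hh : Measurable h) :
    ∫⁻ z in φ '' s, h z ∂Measure.euclideanHausdorffMeasure (finrank ℝ E) =
      ∫⁻ y in s, h (φ y) * ENNReal.ofReal (fderiv ℝ φ y).toLinearMap.normDet := by
  set J : E → ℝ≥0∞ := fun y => ENNReal.ofReal (fderiv ℝ φ y).toLinearMap.normDet with hJ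
  have hφc : ContinuousOn φ s := fun y hy => (hφ y hy).continuousAt.continuousWithinAt
  have hJm : AEMeasurable J (volume.restrict s) := by
    refine ENNReal.measurable_ofReal.comp_aemeasurable
      (ContinuousOn.aemeasurable (fun y hy => ?_) hs.measurableSet)
    exact (continuous_normDet.continuousAt.comp
      ((hφ y hy).continuousAt_fderiv one_ne_zero)).continuousWithinAt
  -- φ is only controlled on `s`; a globally measurable replacement is needed to push measures
  -- forward.
  obtain ⟨ψ, hψ, hψs⟩ : ∃ ψ : E → F, Measurable ψ ∧ EqOn ψ φ s := by
    classical
    exact ⟨s.piecewise φ fun _ => 0,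
      hφc.measurable_piecewise continuousOn_const hs.measurableSet, piecewise_eqOn _ _ _⟩
  have hmeas : (Measure.euclideanHausdorffMeasure (finrank ℝ E)).restrict (φ '' s) =
      ((volume.restrict s).withDensity J).map ψ := by
    ext B hB
    have hBs : B ∩ φ '' s = φ '' (ψ ⁻¹' B ∩ s) := by
      ext z
      constructor
      · rintro ⟨hz, y, hy, rfl⟩
        exact ⟨y, ⟨by rwa [mem_preimage, hψs hy], hy⟩, rfl⟩
      · rintro ⟨y, ⟨hyB, hy⟩, rfl⟩
        rw [mem_preimage, hψs hy] at hyB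
        exact ⟨hyB, y, hy, rfl⟩
    rw [Measure.restrict_apply hB, Measure.map_apply hψ hB, withDensity_apply _ (hψ hB),
      Measure.restrict_restrict (hψ hB), hBs]
    exact euclideanHausdorffMeasure_image_eq_lintegral hφ hinj hT inter_subset_right
      ((hψ hB).inter hs.measurableSet)
  rw [hmeas, lintegral_map hh hψ, show (fun a => h (ψ a)) = h ∘ ψ from rfl,
    lintegral_withDensity_eq_lintegral_mul₀ hJm (hh.comp hψ).aemeasurable]
  refine setLIntegral_congr_fun hs.measurableSet fun y hy => ?_
  simp only [Pi.mul_apply, Function.comp_apply, hψs hy, hJ, mul_comm]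

end AreaFormula

/-! ### The extremal problem on a single fiber: Hölder bound, equality, uniqueness. -/

section Fiber

variable {Y : Type*} [MeasurableSpace Y] {ν : Measure Y} {p q : ℝ} {w G : Y → ℝ≥0∞}

theorem lintegral_inv_mul_rpow_mul {L : ℝ≥0∞} (hw : Measurable w)
    (hw0 : ∀ y, w y ≠ 0) (hwt : ∀ y, w y ≠ ∞) (hL0 : L ≠ 0) (hLt : L ≠ ∞)
    (hL : L = ∫⁻ y, w y ^ q ∂ν) :
    ∫⁻ y, L⁻¹ * w y ^ (q - 1) * w y ∂ν = 1 := by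
  have : ∀ y, L⁻¹ * w y ^ (q - 1) * w y = L⁻¹ * w y ^ q := fun y => by
    rw [mul_assoc]
    congr 1
    conv_lhs => rw [← ENNReal.rpow_one (w y), ← ENNReal.rpow_mul, one_mul,
      ← ENNReal.rpow_add _ _ (hw0 y) (hwt y), sub_add_cancel]
  simp_rw [this]
  rw [lintegral_const_mul _ (hw.pow_const q), ← hL, ENNReal.inv_mul_cancel hL0 hLt]

theorem lintegral_inv_mul_rpow_rpow (hpq : p.HolderConjugate q) {L : ℝ≥0∞} (hw : Measurable w)
    (hL0 : L ≠ 0) (hL : L = ∫⁻ y, w y ^ q ∂ν) :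
    ∫⁻ y, (L⁻¹ * w y ^ (q - 1)) ^ p ∂ν = L ^ (1 - p) := by
  have hp := hpq.pos
  have : ∀ y, (L⁻¹ * w y ^ (q - 1)) ^ p = L⁻¹ ^ p * w y ^ q := fun y => by
    rw [ENNReal.mul_rpow_of_nonneg _ _ hp.le, ← ENNReal.rpow_mul]
    congr 2
    have := hpq.symm.sub_one_mul_conj
    linarith
  simp_rw [this]
  rw [lintegral_const_mul _ (hw.pow_const q), ← hL]
  rcases eq_or_ne L ∞ with rfl | hLt
  · rw [ENNReal.inv_top, ENNReal.zero_rpow_of_pos hp, zero_mul,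
      ENNReal.top_rpow_of_neg (by linarith [hpq.lt])]
  · rw [sub_eq_add_neg, ENNReal.rpow_add _ _ hL0 hLt, ENNReal.rpow_one, ENNReal.rpow_neg,
      ENNReal.inv_rpow, mul_comm]

/-- Hölder turns the constraint into 1 ≤ ‖G‖_p L^(1/q); raising to the power p and using p/q = p - 1
gives the bound. For L = ∞ the left side is 0. -/
theorem rpow_le_lintegral_rpow (hpq : p.HolderConjugate q) {L : ℝ≥0∞} (hw : Measurable w)
    (hG : AEMeasurable G ν) (hL0 : L ≠ 0) (hL : L = ∫⁻ y, w y ^ q ∂ν)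
    (h1 : 1 ≤ ∫⁻ y, G y * w y ∂ν) :
    L ^ (1 - p) ≤ ∫⁻ y, G y ^ p ∂ν := by
  have hp := hpq.pos
  rcases eq_or_ne L ∞ with rfl | hLt
  · rw [ENNReal.top_rpow_of_neg (by linarith [hpq.lt])]
    exact zero_le
  have h2 := h1.trans (ENNReal.lintegral_mul_le_Lp_mul_Lq ν hpq hG hw.aemeasurable)
  rw [← hL] at h2
  have h3 := ENNReal.rpow_le_rpow h2 hp.le
  rw [ENNReal.one_rpow, ENNReal.mul_rpow_of_nonneg _ _ hp.le, ← ENNReal.rpow_mul,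
    one_div_mul_cancel hp.ne', ENNReal.rpow_one, ← ENNReal.rpow_mul,
    show 1 / q * p = p - 1 by rw [one_div, mul_comm, ← div_eq_mul_inv, hpq.div_conj_eq_sub_one]] at h3
  have h4 : L ^ (1 - p) * L ^ (p - 1) = 1 := by
    rw [← ENNReal.rpow_add _ _ hL0 hLt]
    simp
  calc L ^ (1 - p) ≤ L ^ (1 - p) * ((∫⁻ y, G y ^ p ∂ν) * L ^ (p - 1)) := by
        simpa using mul_le_mul_right h3 (L ^ (1 - p))
    _ = (∫⁻ y, G y ^ p ∂ν) * (L ^ (1 - p) * L ^ (p - 1)) := by ring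
    _ = _ := by rw [h4, mul_one]

theorem eq_of_rpow_midpoint_eq {a b : ℝ≥0∞} (hp : 1 < p) (ha : a ≠ ∞) (hb : b ≠ ∞)
    (h : (1 / 2 * a + 1 / 2 * b) ^ p = 1 / 2 * a ^ p + 1 / 2 * b ^ p) : a = b := by
  have hp0 : 0 ≤ p := by linarith
  by_contra hab
  lift a to ℝ≥0 using ha
  lift b to ℝ≥0 using hb
  have hab' : (a : ℝ) ≠ b := by exact_mod_cast hab
  have := (strictConvexOn_rpow hp).2 (mem_Ici.2 a.coe_nonneg) (mem_Ici.2 b.coe_nonneg) hab'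
    (by norm_num : (0 : ℝ) < 1 / 2) (by norm_num : (0 : ℝ) < 1 / 2) (by norm_num)
  simp only [smul_eq_mul] at this
  have h' := congrArg ENNReal.toReal h
  rw [← ENNReal.toReal_rpow] at h'
  rw [ENNReal.toReal_add (by finiteness) (by finiteness),
    ENNReal.toReal_add (by finiteness) (by finiteness)] at h'
  simp only [ENNReal.toReal_mul, ENNReal.toReal_div, ENNReal.toReal_one, ENNReal.toReal_ofNat,
    ENNReal.coe_toReal, ← ENNReal.toReal_rpow] at h'
  linarith

theorem ae_eq_of_lintegral_rpow_eq (hpq : p.HolderConjugate q) {L : ℝ≥0∞} (hw : Measurable w)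
    (hw0 : ∀ y, w y ≠ 0) (hwt : ∀ y, w y ≠ ∞)
    (hG : Measurable G) (hL0 : L ≠ 0) (hL : L = ∫⁻ y, w y ^ q ∂ν)
    (h1 : 1 ≤ ∫⁻ y, G y * w y ∂ν) (heq : ∫⁻ y, G y ^ p ∂ν = L ^ (1 - p)) :
    ∀ᵐ y ∂ν, G y = L⁻¹ * w y ^ (q - 1) := by
  have hp := hpq.pos
  rcases eq_or_ne L ∞ with rfl | hLt
  -- For L = ∞ the energy is 0, so G = 0 almost everywhere, which is the claimed value because ∞⁻¹ =
  -- 0.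
  · rw [ENNReal.top_rpow_of_neg (by linarith [hpq.lt]), lintegral_eq_zero_iff (hG.pow_const p)]
      at heq
    filter_upwards [heq] with y hy
    simpa [hp, hp.not_gt] using hy
  set F : Y → ℝ≥0∞ := fun y => L⁻¹ * w y ^ (q - 1)
  have hFm : Measurable F := (hw.pow_const _).const_mul _
  have hFp : ∫⁻ y, F y ^ p ∂ν = L ^ (1 - p) := lintegral_inv_mul_rpow_rpow hpq hw hL0 hL
  have hF1 : ∫⁻ y, F y * w y ∂ν = 1 := lintegral_inv_mul_rpow_mul hw hw0 hwt hL0 hLt hL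
  have hLp : L ^ (1 - p) ≠ ∞ := by simp [ENNReal.rpow_eq_top_iff, hL0, hLt]
  have half : (1 / 2 : ℝ≥0∞) + 1 / 2 = 1 := by simpa using ENNReal.inv_two_add_inv_two
  have hGw : Measurable fun y => G y * w y := hG.mul hw
  have hFw : Measurable fun y => F y * w y := hFm.mul hw
  -- The midpoint of G and the model minimizer F still satisfies the constraint, so its energy
  -- cannot drop below the minimum; convexity of t^p must then be an equality almost everywhere.
  have hmid : 1 ≤ ∫⁻ y, (1 / 2 * G y + 1 / 2 * F y) * w y ∂ν := by
    have : ∀ y, (1 / 2 * G y + 1 / 2 * F y) * w y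
        = 1 / 2 * (G y * w y) + 1 / 2 * (F y * w y) := fun y => by ring
    simp_rw [this]
    rw [lintegral_add_left (hGw.const_mul _), lintegral_const_mul _ hGw,
      lintegral_const_mul _ hFw, hF1, mul_one]
    refine half.symm.le.trans ?_
    gcongr
    simpa using mul_le_mul_right h1 (1 / 2 : ℝ≥0∞)
  have hmidm : Measurable fun y => 1 / 2 * G y + 1 / 2 * F y :=
    (hG.const_mul _).add (hFm.const_mul _)
  have hlow := rpow_le_lintegral_rpow hpq hw hmidm.aemeasurable hL0 hL hmid
  have hup : ∫⁻ y, (1 / 2 * G y ^ p + 1 / 2 * F y ^ p) ∂ν = L ^ (1 - p) := by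
    rw [lintegral_add_left ((hG.pow_const p).const_mul _), lintegral_const_mul _ (hG.pow_const p),
      lintegral_const_mul _ (hFm.pow_const p), hFp, heq, ← add_mul, half, one_mul]
  have hle : ∀ y, (1 / 2 * G y + 1 / 2 * F y) ^ p ≤ 1 / 2 * G y ^ p + 1 / 2 * F y ^ p :=
    fun y => ENNReal.rpow_arith_mean_le_arith_mean2_rpow _ _ _ _ half hpq.lt.le
  have hae := ae_eq_of_ae_le_of_lintegral_le (Eventually.of_forall hle)
    (ne_top_of_le_ne_top hLp ((lintegral_mono hle).trans hup.le))
    (((hG.pow_const p).const_mul _).add ((hFm.pow_const p).const_mul _)).aemeasurable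
    (hup.le.trans hlow)
  have hGt : ∀ᵐ y ∂ν, G y ^ p < ∞ := ae_lt_top (hG.pow_const p) (heq ▸ hLp)
  filter_upwards [hae, hGt] with y hy hGy
  refine eq_of_rpow_midpoint_eq hpq.lt ?_ ?_ hy
  · rintro h
    simp [h, hp] at hGy
  · exact ENNReal.mul_ne_top (ENNReal.inv_ne_top.2 hL0)
      (by simp [ENNReal.rpow_eq_top_iff, hw0 y, hwt y])

end Fiber

/-! ### Fibers of infinite weight carry arbitrarily small energy. -/

section Truncation

variable {X Y : Type*} [MeasurableSpace X] [MeasurableSpace Y] {α : Measure X} {β : Measure Y}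
  [SigmaFinite α] [SigmaFinite β] {p q : ℝ} {w J : X × Y → ℝ≥0∞}

/-- If the weights `∫ w ^ q J dβ` are infinite for some parameters, then functions that are
admissible for these parameters can have arbitrarily small energy. -/
theorem exists_lintegral_rpow_le_of_eq_top (hpq : p.HolderConjugate q) (hw : Measurable w)
    (hw0 : ∀ z, w z ≠ 0) (hwt : ∀ z, w z ≠ ∞) (hJ : Measurable J) (hJt : ∀ z, J z ≠ ∞)
    {ε : ℝ≥0∞} (hε : ε ≠ 0) :
    ∃ G : X × Y → ℝ≥0∞, Measurable G ∧
      (∀ x, ∫⁻ y, w (x, y) ^ q * J (x, y) ∂β = ∞ → 1 ≤ ∫⁻ y, G (x, y) * w (x, y) * J (x, y) ∂β) ∧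
      ∫⁻ x, ∫⁻ y, G (x, y) ^ p * J (x, y) ∂β ∂α ≤ ε := by
  classical
  have hp := hpq.pos
  have hp1 : 1 - p < 0 := by linarith [hpq.lt]
  obtain ⟨φ, hφ0, hφm, hφε⟩ := exists_pos_lintegral_lt_of_sigmaFinite α hε
  set H : X × Y → ℝ≥0∞ := fun z => w z ^ q * J z with hH
  have hHm : Measurable H := (hw.pow_const q).mul hJ
  have hHt : ∀ z, H z ≠ ∞ := fun z => ENNReal.mul_ne_top
    (by simp [ENNReal.rpow_eq_top_iff, hw0 z, hwt z]) (hJt z)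
  -- Bounding both the fiber measure and the integrand makes each truncated weight `l k x` finite,
  -- while the sets exhaust the space.
  set D : ℕ → Set (X × Y) := fun k => {z | z.2 ∈ spanningSets β k ∧ H z ≤ k}
  have hDm : ∀ k, MeasurableSet (D k) := fun k =>
    (measurable_snd (measurableSet_spanningSets β k)).inter (measurableSet_le hHm measurable_const)
  have hDmono : Monotone D := fun i j hij z hz =>
    ⟨monotone_spanningSets β hij hz.1, hz.2.trans (by exact_mod_cast hij)⟩
  have hDU : ∀ z, ∃ k, z ∈ D k := fun z => by
    obtain ⟨i, hi⟩ := mem_iUnion.1 (iUnion_spanningSets β ▸ mem_univ z.2)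
    obtain ⟨j, hj⟩ := ENNReal.exists_nat_gt (hHt z)
    exact ⟨max i j, monotone_spanningSets β (le_max_left i j) hi,
      hj.le.trans (by exact_mod_cast le_max_right i j)⟩
  have hDHm : ∀ k x, Measurable fun y => (D k).indicator H (x, y) := fun k x =>
    (hHm.indicator (hDm k)).comp measurable_prodMk_left
  set l : ℕ → X → ℝ≥0∞ := fun k x => ∫⁻ y, (D k).indicator H (x, y) ∂β
  have hlm : ∀ k, Measurable (l k) := fun k => (hHm.indicator (hDm k)).lintegral_prod_right'
  have hlt : ∀ k x, l k x ≠ ∞ := fun k x => by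
    refine ne_top_of_le_ne_top (ENNReal.mul_ne_top (ENNReal.natCast_ne_top k)
      (measure_spanningSets_lt_top β k).ne) ?_
    rw [← setLIntegral_const, ← lintegral_indicator (measurableSet_spanningSets β k)]
    refine lintegral_mono fun y => ?_
    by_cases hy : (x, y) ∈ D k
    · rw [indicator_of_mem hy, indicator_of_mem hy.1]
      exact hy.2
    · rw [indicator_of_notMem hy]
      exact zero_le
  have hlsup : ∀ x, ⨆ k, l k x = ∫⁻ y, H (x, y) ∂β := fun x => by
    rw [← lintegral_iSup (fun k => hDHm k x)
      fun i j hij y => indicator_le_indicator_of_subset (hDmono hij) (fun _ => zero_le) (x, y)]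
    congr 1 with y
    obtain ⟨k, hk⟩ := hDU (x, y)
    refine le_antisymm (iSup_le fun i => indicator_le_self _ _ _) (le_iSup_of_le k ?_)
    rw [indicator_of_mem hk]
  -- Selects a truncation level at which the fiber energy is below φ(x), where φ > 0 has integral
  -- less than ε. The condition is vacuous on fibers of finite weight, so a least level always
  -- exists; it depends only on `z.1`, so the level is constant on each fiber.
  set P : ℕ → X × Y → Prop := fun k z =>
    ∫⁻ y, H (z.1, y) ∂β = ∞ → l k z.1 ^ (1 - p) ≤ φ z.1
  have hPm : ∀ k, MeasurableSet {z | P k z} := fun k =>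
    (((hHm.lintegral_prod_right' (measurableSet_singleton ∞)).imp
      (measurableSet_le ((hlm k).pow_const (1 - p)) hφm.coe_nnreal_ennreal))).preimage measurable_fst
  have hPe : ∀ z, ∃ k, P k z := fun z => by
    by_cases hz : ∫⁻ y, H (z.1, y) ∂β = ∞
    · rw [← hlsup, iSup_eq_top] at hz
      obtain ⟨k, hk⟩ := hz ((φ z.1 : ℝ≥0∞) ^ (1 - p)⁻¹) (by
        have := hφ0 z.1
        simp [lt_top_iff_ne_top, ENNReal.rpow_eq_top_iff, this.ne'])
      refine ⟨k, fun _ => ?_⟩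
      have := ENNReal.rpow_le_rpow hk.le (neg_nonneg.2 hp1.le)
      rw [ENNReal.rpow_neg, ENNReal.rpow_neg, ENNReal.inv_le_inv] at this
      rwa [← ENNReal.rpow_mul, inv_mul_cancel₀ hp1.ne, ENNReal.rpow_one] at this
    · exact ⟨0, fun h => absurd h hz⟩
  -- The fiber minimizer for the truncated weight: its constraint integral is 1 and its energy is `l
  -- k x ^ (1 - p)`.
  set g : ℕ → X × Y → ℝ≥0∞ := fun k => (D k).indicator fun z => (l k z.1)⁻¹ * w z ^ (q - 1) with hg
  have hgm : ∀ k, Measurable (g k) := fun k =>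
    (((hlm k).comp measurable_fst).inv.mul (hw.pow_const _)).indicator (hDm k)
  have hTm : MeasurableSet {z : X × Y | ∫⁻ y, H (z.1, y) ∂β = ∞} :=
    (hHm.lintegral_prod_right' (measurableSet_singleton ∞)).preimage measurable_fst
  have hval : ∀ x, ∫⁻ y, H (x, y) ∂β = ∞ → ∃ k, l k x ^ (1 - p) ≤ φ x ∧
      ∀ y, ({z : X × Y | ∫⁻ y, H (z.1, y) ∂β = ∞}.indicator
        fun z => g (Nat.find (hPe z)) z) (x, y) = g k (x, y) := fun x hx => by
    by_cases hY : Nonempty Y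
    · obtain ⟨y₀⟩ := hY
      exact ⟨Nat.find (hPe (x, y₀)), Nat.find_spec (hPe (x, y₀)) hx, fun y =>
        indicator_of_mem (s := {z : X × Y | ∫⁻ y, H (z.1, y) ∂β = ∞}) hx _⟩
    · rw [not_nonempty_iff] at hY
      rw [lintegral_of_isEmpty] at hx
      exact absurd hx ENNReal.zero_ne_top
  refine ⟨{z : X × Y | ∫⁻ y, H (z.1, y) ∂β = ∞}.indicator fun z => g (Nat.find (hPe z)) z,
    (Measurable.find hgm hPm hPe).indicator hTm, fun x hx => ?_, ?_⟩
  · obtain ⟨k, hk, hkg⟩ := hval x hx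
    have hl0 : l k x ≠ 0 := fun h => by simp [h, ENNReal.zero_rpow_of_neg hp1] at hk
    simp_rw [hkg]
    have : ∀ y, g k (x, y) * w (x, y) * J (x, y) = (l k x)⁻¹ * (D k).indicator H (x, y) := by
      intro y
      by_cases hy : (x, y) ∈ D k
      · simp only [hg, indicator_of_mem hy, hH]
        have : w (x, y) ^ (q - 1) * w (x, y) = w (x, y) ^ q := by
          conv_lhs => rw [← ENNReal.rpow_one (w (x, y)), ← ENNReal.rpow_mul, one_mul,
            ← ENNReal.rpow_add _ _ (hw0 _) (hwt _), sub_add_cancel]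
        rw [← this]
        ring
      · simp [hg, indicator_of_notMem hy]
    simp_rw [this]
    rw [lintegral_const_mul _ (hDHm k x),
      ENNReal.inv_mul_cancel hl0 (hlt k x)]
  · refine le_trans (lintegral_mono fun x => ?_) hφε.le
    by_cases hx : ∫⁻ y, H (x, y) ∂β = ∞
    · obtain ⟨k, hk, hkg⟩ := hval x hx
      have hl0 : l k x ≠ 0 := fun h => by simp [h, ENNReal.zero_rpow_of_neg hp1] at hk
      simp_rw [hkg]
      have : ∀ y, g k (x, y) ^ p * J (x, y) = (l k x)⁻¹ ^ p * (D k).indicator H (x, y) := by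
        intro y
        by_cases hy : (x, y) ∈ D k
        · simp only [hg, indicator_of_mem hy, hH]
          rw [ENNReal.mul_rpow_of_nonneg _ _ hp.le, ← ENNReal.rpow_mul,
            show (q - 1) * p = q by linarith [hpq.symm.sub_one_mul_conj], mul_assoc]
        · simp [hg, indicator_of_notMem hy, hp]
      simp_rw [this]
      rw [lintegral_const_mul _ (hDHm k x)]
      refine le_of_eq_of_le ?_ hk
      change (l k x)⁻¹ ^ p * l k x = _
      rw [sub_eq_add_neg, ENNReal.rpow_add _ _ hl0 (hlt k x), ENNReal.rpow_one, ENNReal.rpow_neg,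
        ENNReal.inv_rpow, mul_comm]
    · have : ∀ y, ({z : X × Y | ∫⁻ y, H (z.1, y) ∂β = ∞}.indicator
        fun z => g (Nat.find (hPe z)) z) (x, y) = 0 := fun y =>
        indicator_of_notMem (s := {z : X × Y | ∫⁻ y, H (z.1, y) ∂β = ∞}) hx _
      simp [this, hp]

end Truncation

/-! ### Integrating the fiber problem over the parameter, in an abstract setting. -/

section Fibered

variable {X Y Z : Type*} [MeasurableSpace X] [MeasurableSpace Y] [MeasurableSpace Z]

/-- The measures `σ x`, `x ∈ U`, on `Z` are parametrized through `φ (x, ·)` with density `w J`,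
and the measure `ζ` on `Z` is parametrized by `φ` with density `J`. -/
structure IsFibered (α : Measure X) (β : Measure Y) (ζ : Measure Z) (U : Set X)
    (σ : X → Measure Z) (φ : X × Y → Z) (w J : X × Y → ℝ≥0∞) : Prop where
  measurable_map : Measurable φ
  measurable_weight : Measurable w
  weight_ne_zero : ∀ z, w z ≠ 0
  weight_ne_top : ∀ z, w z ≠ ∞
  measurable_jacobian : Measurable J
  jacobian_ne_zero : ∀ z, J z ≠ 0
  jacobian_ne_top : ∀ z, J z ≠ ∞
  ae_mem : ∀ᵐ x ∂α, x ∈ U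
  lintegral_fiber : ∀ x ∈ U, ∀ g : Z → ℝ≥0∞, Measurable g →
    ∫⁻ z, g z ∂σ x = ∫⁻ y, g (φ (x, y)) * w (x, y) * J (x, y) ∂β
  lintegral_total : ∀ g : Z → ℝ≥0∞, Measurable g →
    ∫⁻ z, g z ∂ζ = ∫⁻ x, ∫⁻ y, g (φ (x, y)) * J (x, y) ∂β ∂α
  exists_lift : ∀ G : X × Y → ℝ≥0∞, Measurable G →
    ∃ g : Z → ℝ≥0∞, Measurable g ∧ ∀ x ∈ U, ∀ᵐ y ∂β, g (φ (x, y)) = G (x, y)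

variable {α : Measure X} {β : Measure Y} {ζ : Measure Z} {U : Set X} {σ : X → Measure Z}
  {φ : X × Y → Z} {w J : X × Y → ℝ≥0∞} {p q : ℝ}

/-- The integral `∫ w ^ q J dβ` over the fiber of `x`. -/
noncomputable def fiberWeight (β : Measure Y) (w J : X × Y → ℝ≥0∞) (q : ℝ) (x : X) : ℝ≥0∞ :=
  ∫⁻ y, w (x, y) ^ q * J (x, y) ∂β

namespace IsFibered

theorem measurable_slice {W : Type*} [MeasurableSpace W] {h : X × Y → W} (hh : Measurable h)
    (x : X) : Measurable fun y => h (x, y) :=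
  hh.comp measurable_prodMk_left

theorem lintegral_withDensity (h : IsFibered α β ζ U σ φ w J) (x : X) {g : Y → ℝ≥0∞}
    (hg : Measurable g) :
    ∫⁻ y, g y ∂β.withDensity (fun y => J (x, y)) = ∫⁻ y, g y * J (x, y) ∂β := by
  rw [lintegral_withDensity_eq_lintegral_mul _ (measurable_slice h.measurable_jacobian x) hg]
  simp only [Pi.mul_apply, mul_comm]

theorem fiberWeight_eq (h : IsFibered α β ζ U σ φ w J) (q : ℝ) (x : X) :
    fiberWeight β w J q x = ∫⁻ y, w (x, y) ^ q ∂β.withDensity (fun y => J (x, y)) :=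
  (h.lintegral_withDensity x ((measurable_slice h.measurable_weight x).pow_const q)).symm

theorem measurable_fiberWeight [SFinite β] (h : IsFibered α β ζ U σ φ w J) (q : ℝ) :
    Measurable (fiberWeight β w J q) :=
  ((h.measurable_weight.pow_const q).mul h.measurable_jacobian).lintegral_prod_right'

theorem fiberWeight_ne_zero [NeZero β] (h : IsFibered α β ζ U σ φ w J) (q : ℝ) (x : X) :
    fiberWeight β w J q x ≠ 0 := by
  rw [fiberWeight, Ne, lintegral_eq_zero_iff (((measurable_slice h.measurable_weight x).pow_const
    q).fun_mul (measurable_slice h.measurable_jacobian x))]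
  intro h0
  obtain ⟨y, hy⟩ := h0.exists
  simp [ENNReal.rpow_eq_zero_iff, h.weight_ne_zero, h.weight_ne_top, h.jacobian_ne_zero] at hy

theorem one_le_of_isAdmissible (h : IsFibered α β ζ U σ φ w J) {g : Z → ℝ≥0∞}
    (hg : IsAdmissible (σ '' U) g) {x : X} (hx : x ∈ U) :
    1 ≤ ∫⁻ y, g (φ (x, y)) * w (x, y) ∂β.withDensity (fun y => J (x, y)) := by
  have hgm : Measurable fun y => g (φ (x, y)) := hg.1.comp (measurable_slice h.measurable_map x)
  rw [h.lintegral_withDensity x (hgm.fun_mul (measurable_slice h.measurable_weight x)),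
    ← h.lintegral_fiber x hx g hg.1]
  exact hg.2 _ (mem_image_of_mem σ hx)

theorem rpow_fiberWeight_le [NeZero β] (h : IsFibered α β ζ U σ φ w J)
    (hpq : p.HolderConjugate q) {g : Z → ℝ≥0∞} (hg : IsAdmissible (σ '' U) g) {x : X}
    (hx : x ∈ U) :
    fiberWeight β w J q x ^ (1 - p) ≤ ∫⁻ y, g (φ (x, y)) ^ p * J (x, y) ∂β := by
  have hgm := hg.1.comp (measurable_slice h.measurable_map x)
  refine (rpow_le_lintegral_rpow hpq (measurable_slice h.measurable_weight x) hgm.aemeasurable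
    (h.fiberWeight_ne_zero q x) (h.fiberWeight_eq q x) (h.one_le_of_isAdmissible hg hx)).trans ?_
  exact (h.lintegral_withDensity x (hgm.pow_const p)).le

theorem lintegral_rpow_fiberWeight_le [NeZero β] (h : IsFibered α β ζ U σ φ w J)
    (hpq : p.HolderConjugate q) {g : Z → ℝ≥0∞} (hg : IsAdmissible (σ '' U) g) :
    ∫⁻ x, fiberWeight β w J q x ^ (1 - p) ∂α ≤ ∫⁻ z, g z ^ p ∂ζ := by
  rw [h.lintegral_total _ (hg.1.pow_const p)]
  exact lintegral_mono_ae (h.ae_mem.mono fun x hx => h.rpow_fiberWeight_le hpq hg hx)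

section Extremal

variable {f : Z → ℝ≥0∞}

theorem lintegral_fiber_rpow [NeZero β] (h : IsFibered α β ζ U σ φ w J)
    (hpq : p.HolderConjugate q)
    (hfφ : ∀ x ∈ U, ∀ᵐ y ∂β, f (φ (x, y)) = (fiberWeight β w J q x)⁻¹ * w (x, y) ^ (q - 1))
    {x : X} (hx : x ∈ U) :
    ∫⁻ y, f (φ (x, y)) ^ p * J (x, y) ∂β = fiberWeight β w J q x ^ (1 - p) := by
  have hwx := measurable_slice h.measurable_weight x
  rw [← lintegral_inv_mul_rpow_rpow hpq hwx (h.fiberWeight_ne_zero q x) (h.fiberWeight_eq q x),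
    h.lintegral_withDensity x (((hwx.pow_const _).const_mul _).pow_const _)]
  refine lintegral_congr_ae ?_
  filter_upwards [hfφ x hx] with y hy
  rw [hy]

/-- Fibers of infinite weight cause no exception: there f vanishes almost everywhere, and ∞^(1-p) =
0. -/
theorem lintegral_rpow_eq [NeZero β] (h : IsFibered α β ζ U σ φ w J)
    (hpq : p.HolderConjugate q) (hf : Measurable f)
    (hfφ : ∀ x ∈ U, ∀ᵐ y ∂β, f (φ (x, y)) = (fiberWeight β w J q x)⁻¹ * w (x, y) ^ (q - 1)) :
    ∫⁻ z, f z ^ p ∂ζ = ∫⁻ x, fiberWeight β w J q x ^ (1 - p) ∂α := by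
  rw [h.lintegral_total _ (hf.pow_const p)]
  exact lintegral_congr_ae (h.ae_mem.mono fun x hx => h.lintegral_fiber_rpow hpq hfφ hx)

theorem isAdmissible_of_ne_top [NeZero β] (h : IsFibered α β ζ U σ φ w J)
    (hf : Measurable f)
    (hfφ : ∀ x ∈ U, ∀ᵐ y ∂β, f (φ (x, y)) = (fiberWeight β w J q x)⁻¹ * w (x, y) ^ (q - 1)) :
    IsAdmissible (σ '' {x ∈ U | fiberWeight β w J q x ≠ ∞}) f := by
  refine ⟨hf, ?_⟩
  rintro _ ⟨x, ⟨hx, hxt⟩, rfl⟩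
  have hwx := measurable_slice h.measurable_weight x
  rw [h.lintegral_fiber x hx f hf, ← lintegral_inv_mul_rpow_mul hwx
    (fun y => h.weight_ne_zero (x, y)) (fun y => h.weight_ne_top (x, y))
    (h.fiberWeight_ne_zero q x) hxt (h.fiberWeight_eq q x),
    h.lintegral_withDensity x (((hwx.pow_const _).const_mul _).fun_mul hwx)]
  refine (lintegral_congr_ae ?_).le
  filter_upwards [hfφ x hx] with y hy
  rw [hy]

theorem exists_isAdmissible_of_eq_top [SigmaFinite α] [SigmaFinite β]
    (h : IsFibered α β ζ U σ φ w J) (hpq : p.HolderConjugate q) {ε : ℝ≥0∞} (hε : ε ≠ 0) :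
    ∃ g, IsAdmissible (σ '' {x ∈ U | fiberWeight β w J q x = ∞}) g ∧ ∫⁻ z, g z ^ p ∂ζ ≤ ε := by
  obtain ⟨G, hG, hG1, hGε⟩ := exists_lintegral_rpow_le_of_eq_top (α := α) (β := β) hpq
    h.measurable_weight h.weight_ne_zero h.weight_ne_top h.measurable_jacobian h.jacobian_ne_top hε
  obtain ⟨g, hg, hgG⟩ := h.exists_lift G hG
  refine ⟨g, ⟨hg, ?_⟩, ?_⟩
  · rintro _ ⟨x, ⟨hx, hxt⟩, rfl⟩
    rw [h.lintegral_fiber x hx g hg]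
    refine (hG1 x hxt).trans (lintegral_congr_ae ?_).le
    filter_upwards [hgG x hx] with y hy
    rw [hy]
  · rw [h.lintegral_total _ (hg.pow_const p)]
    refine le_trans (lintegral_mono_ae (h.ae_mem.mono fun x hx => ?_)) hGε
    refine (lintegral_congr_ae ?_).le
    filter_upwards [hgG x hx] with y hy
    rw [hy]

theorem modulus_eq_zero_of_eq_top [SigmaFinite α] [SigmaFinite β]
    (h : IsFibered α β ζ U σ φ w J) (hpq : p.HolderConjugate q) :
    modulus p ζ (σ '' {x ∈ U | fiberWeight β w J q x = ∞}) = 0 := by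
  refine le_antisymm (le_of_forall_pos_le_add fun ε hε => ?_) zero_le
  obtain ⟨g, hg, hgε⟩ := h.exists_isAdmissible_of_eq_top hpq hε.ne'
  rw [zero_add]
  exact (iInf₂_le g hg).trans hgε

theorem modulus_eq [SigmaFinite α] [SigmaFinite β] [NeZero β]
    (h : IsFibered α β ζ U σ φ w J) (hpq : p.HolderConjugate q) (hf : Measurable f)
    (hfφ : ∀ x ∈ U, ∀ᵐ y ∂β, f (φ (x, y)) = (fiberWeight β w J q x)⁻¹ * w (x, y) ^ (q - 1)) :
    modulus p ζ (σ '' U) = ∫⁻ x, fiberWeight β w J q x ^ (1 - p) ∂α := by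
  refine le_antisymm ?_ (le_iInf₂ fun g hg => h.lintegral_rpow_fiberWeight_le hpq hg)
  refine le_of_forall_pos_le_add fun ε hε => ?_
  obtain ⟨g, hg, hgε⟩ := h.exists_isAdmissible_of_eq_top hpq hε.ne'
  have hfa := h.isAdmissible_of_ne_top hf hfφ
  -- f serves the fibers of finite weight and g the others; the maximum costs no more than the sum
  -- of the two energies.
  have hadm : IsAdmissible (σ '' U) fun z => max (f z) (g z) := by
    refine ⟨hf.max hg.1, ?_⟩
    rintro _ ⟨x, hx, rfl⟩
    by_cases hxt : fiberWeight β w J q x = ∞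
    · exact (hg.2 _ (mem_image_of_mem σ ⟨hx, hxt⟩)).trans (lintegral_mono fun z => le_max_right _ _)
    · exact (hfa.2 _ (mem_image_of_mem σ ⟨hx, hxt⟩)).trans (lintegral_mono fun z => le_max_left _ _)
  calc modulus p ζ (σ '' U) ≤ ∫⁻ z, max (f z) (g z) ^ p ∂ζ := iInf₂_le _ hadm
    _ ≤ ∫⁻ z, (f z ^ p + g z ^ p) ∂ζ := by
        refine lintegral_mono fun z => ?_
        rcases max_choice (f z) (g z) with hz | hz
        · rw [hz]; exact le_self_add
        · rw [hz]; exact le_add_self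
    _ = ∫⁻ z, f z ^ p ∂ζ + ∫⁻ z, g z ^ p ∂ζ := lintegral_add_left (hf.pow_const p) _
    _ ≤ _ := by
        rw [h.lintegral_rpow_eq hpq hf hfφ]
        gcongr

/-- The fiber bounds integrate to an equality between finite quantities, so almost every fiber bound
is sharp, and uniqueness on a fiber applies. Finiteness is what allows this cancellation. -/
theorem ae_eq_of_isExtremal [SigmaFinite α] [SigmaFinite β] [NeZero β]
    (h : IsFibered α β ζ U σ φ w J) (hpq : p.HolderConjugate q) (hf : Measurable f)
    (hfφ : ∀ x ∈ U, ∀ᵐ y ∂β, f (φ (x, y)) = (fiberWeight β w J q x)⁻¹ * w (x, y) ^ (q - 1))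
    (hfin : modulus p ζ (σ '' U) ≠ ∞) {g : Z → ℝ≥0∞} (hg : IsExtremal p ζ (σ '' U) g) :
    g =ᵐ[ζ] f := by
  obtain ⟨hga, hge⟩ := hg
  have hgm : Measurable fun z : X × Y => g (φ z) ^ p * J z :=
    ((hga.1.comp h.measurable_map).pow_const p).mul h.measurable_jacobian
  rw [h.modulus_eq hpq hf hfφ] at hge hfin
  rw [h.lintegral_total _ (hga.1.pow_const p)] at hge
  have hae := ae_eq_of_ae_le_of_lintegral_le
    (h.ae_mem.mono fun x hx => h.rpow_fiberWeight_le hpq hga hx) hfin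
    hgm.lintegral_prod_right'.aemeasurable hge.symm.le
  have hne : MeasurableSet {z | g z ≠ f z} := (measurableSet_eq_fun hga.1 hf).compl
  change ζ {z | g z ≠ f z} = 0
  rw [← lintegral_indicator_one hne, h.lintegral_total _ (measurable_one.indicator hne)]
  refine (lintegral_congr_ae ?_).trans lintegral_zero
  filter_upwards [hae, h.ae_mem] with x hx hxU
  have hwx := measurable_slice h.measurable_weight x
  have hgx : Measurable fun y => g (φ (x, y)) := hga.1.comp (measurable_slice h.measurable_map x)
  have hind : Measurable fun y => {z | g z ≠ f z}.indicator (1 : Z → ℝ≥0∞) (φ (x, y)) :=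
    (measurable_one.indicator hne).comp (measurable_slice h.measurable_map x)
  rw [← h.lintegral_withDensity x (hgx.pow_const p)] at hx
  have hgF := ae_eq_of_lintegral_rpow_eq hpq hwx (fun y => h.weight_ne_zero (x, y))
    (fun y => h.weight_ne_top (x, y)) hgx (h.fiberWeight_ne_zero q x) (h.fiberWeight_eq q x)
    (h.one_le_of_isAdmissible hga hxU) hx.symm
  rw [← h.lintegral_withDensity x hind]
  refine (lintegral_congr_ae ?_).trans lintegral_zero
  filter_upwards [hgF, withDensity_absolutelyContinuous _ _ (hfφ x hxU)] with y hy1 hy2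
  exact indicator_of_notMem (by simp [hy1, hy2]) _

end Extremal

end IsFibered

end Fibered

theorem measurable_indicator_comp {A B C : Type*} [TopologicalSpace A] [MeasurableSpace A]
    [BorelSpace A] [TopologicalSpace B] [MeasurableSpace B] [BorelSpace B] [MeasurableSpace C]
    [Zero C] {s : Set A} (hs : IsOpen s) {ψ : A → B} (hψ : ContinuousOn ψ s) {G : B → C}
    (hG : Measurable G) : Measurable (s.indicator (G ∘ ψ)) := by
  classical
  rcases isEmpty_or_nonempty B with hB | ⟨⟨b⟩⟩
  · have : IsEmpty A := ⟨fun a => hB.elim (ψ a)⟩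
    exact measurable_of_empty _
  have hm : Measurable (s.piecewise ψ fun _ => b) :=
    hψ.measurable_piecewise continuousOn_const hs.measurableSet
  have : s.indicator (G ∘ ψ) = s.indicator (G ∘ s.piecewise ψ fun _ => b) :=
    indicator_congr fun a ha => by simp [ha]
  rw [this]
  exact (hG.comp hm).indicator hs.measurableSet

/-! ### The foliation by the surfaces σ_x as an instance of the abstract setting. -/

section Diffeomorphism

variable {k m n : ℕ}
  {U : Set (EuclideanSpace ℝ (Fin k))} {V : Set (EuclideanSpace ℝ (Fin m))}
  {Ω : Set (EuclideanSpace ℝ (Fin n))}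
  {f : OpenPartialHomeomorph (EuclideanSpace ℝ (Fin k) × EuclideanSpace ℝ (Fin m))
    (EuclideanSpace ℝ (Fin n))}

/-- By the chain rule for f⁻¹ ∘ f = id, the derivative has a left inverse. -/
theorem injective_fderiv_of_contDiffOn_symm {E F : Type*} [NormedAddCommGroup E]
    [NormedSpace ℝ E] [NormedAddCommGroup F] [NormedSpace ℝ F] (f : OpenPartialHomeomorph E F)
    (hf : ContDiffOn ℝ 1 f f.source) (hfinv : ContDiffOn ℝ 1 f.symm f.target) {z : E}
    (hz : z ∈ f.source) : Function.Injective (fderiv ℝ f z) := by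
  have h1 : HasFDerivAt f (fderiv ℝ f z) z :=
    ((hf.contDiffAt (f.open_source.mem_nhds hz)).differentiableAt one_ne_zero).hasFDerivAt
  have h2 : HasFDerivAt f.symm (fderiv ℝ f.symm (f z)) (f z) :=
    ((hfinv.contDiffAt (f.open_target.mem_nhds (f.map_source hz))).differentiableAt
      one_ne_zero).hasFDerivAt
  have h3 : HasFDerivAt (f.symm ∘ f) (ContinuousLinearMap.id ℝ E) z :=
    (hasFDerivAt_id z).congr_of_eventuallyEq (f.eventually_left_inverse hz)
  have h4 := (h2.comp z h1).unique h3
  exact Function.LeftInverse.injective (g := fderiv ℝ f.symm (f z)) fun v => DFunLike.congr_fun h4 v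

theorem hasFDerivAt_slice (hf : ContDiffOn ℝ 1 f f.source) {x : EuclideanSpace ℝ (Fin k)}
    {y : EuclideanSpace ℝ (Fin m)} (hz : (x, y) ∈ f.source) :
    HasFDerivAt (fun y' => f (x, y')) (fderiv ℝ f (x, y) ∘L ContinuousLinearMap.inr ℝ _ _) y :=
  ((hf.contDiffAt (f.open_source.mem_nhds hz)).differentiableAt one_ne_zero).hasFDerivAt.comp y
    (hasFDerivAt_prodMk_right x y)

theorem jacY_eq (hf : ContDiffOn ℝ 1 f f.source) {z : _ × _} (hz : z ∈ f.source) :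
    jacY f z.1 z.2 = (fderiv ℝ f z ∘L ContinuousLinearMap.inr ℝ _ _).toLinearMap.normDet := by
  rw [jacY, (hasFDerivAt_slice hf hz).fderiv]

theorem continuousOn_jacY (hf : ContDiffOn ℝ 1 f f.source) :
    ContinuousOn (fun z : _ × _ => jacY f z.1 z.2) f.source := by
  refine ContinuousOn.congr (f := fun z =>
    (fderiv ℝ f z ∘L ContinuousLinearMap.inr ℝ _ _).toLinearMap.normDet) ?_ fun z hz => jacY_eq hf hz
  exact continuous_normDet.comp_continuousOn
    ((hf.continuousOn_fderiv_of_isOpen f.open_source le_rfl).clm_comp continuousOn_const)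

theorem continuousOn_jac (hf : ContDiffOn ℝ 1 f f.source) :
    ContinuousOn (fun z : _ × _ => jac f z.1 z.2) f.source :=
  continuous_normDet.comp_continuousOn
    ((hf.continuousOn_fderiv_of_isOpen f.open_source le_rfl).clm_comp continuousOn_const)

theorem injective_fderiv_slice (hf : ContDiffOn ℝ 1 f f.source)
    (hfinv : ContDiffOn ℝ 1 f.symm f.target) {x : EuclideanSpace ℝ (Fin k)}
    {y : EuclideanSpace ℝ (Fin m)} (hz : (x, y) ∈ f.source) :
    Function.Injective (fderiv ℝ (fun y' => f (x, y')) y) := by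
  rw [(hasFDerivAt_slice hf hz).fderiv]
  exact (injective_fderiv_of_contDiffOn_symm f hf hfinv hz).comp (LinearMap.inr_injective)

theorem jacY_pos (hf : ContDiffOn ℝ 1 f f.source) (hfinv : ContDiffOn ℝ 1 f.symm f.target)
    {z : _ × _} (hz : z ∈ f.source) : 0 < jacY f z.1 z.2 :=
  normDet_pos (injective_fderiv_slice hf hfinv hz)

theorem jac_pos (hf : ContDiffOn ℝ 1 f f.source) (hfinv : ContDiffOn ℝ 1 f.symm f.target)
    {z : _ × _} (hz : z ∈ f.source) : 0 < jac f z.1 z.2 :=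
  normDet_pos ((injective_fderiv_of_contDiffOn_symm f hf hfinv hz).comp
    (WithLp.prodContinuousLinearEquiv 2 ℝ (EuclideanSpace ℝ (Fin k))
      (EuclideanSpace ℝ (Fin m))).injective)

theorem setLIntegral_surface (hf : ContDiffOn ℝ 1 f f.source)
    (hfinv : ContDiffOn ℝ 1 f.symm f.target) (hV : IsOpen V) {x : EuclideanSpace ℝ (Fin k)}
    (hx : ∀ y ∈ V, (x, y) ∈ f.source) {g : EuclideanSpace ℝ (Fin n) → ℝ≥0∞} (hg : Measurable g) :
    ∫⁻ z in (fun y => f (x, y)) '' V, g z ∂Measure.euclideanHausdorffMeasure m =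
      ∫⁻ y in V, g (f (x, y)) * ENNReal.ofReal (jacY f x y) := by
  have := setLIntegral_image_euclideanHausdorffMeasure (φ := fun y => f (x, y)) hV
    (fun y hy => (hf.contDiffAt (f.open_source.mem_nhds (hx y hy))).comp y
      (contDiffAt_const.prodMk contDiffAt_id))
    (fun y hy y' hy' h => (Prod.ext_iff.1 (f.injOn (hx y hy) (hx y' hy') h)).2)
    (fun y hy => injective_fderiv_slice hf hfinv (hx y hy)) hg
  rwa [finrank_euclideanSpace_fin] at this

/-- Change of variables in a chart whose domain carries a Euclidean structure via `e`. -/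
theorem setLIntegral_target_of_measurePreserving {W E F : Type*} [NormedAddCommGroup W]
    [InnerProductSpace ℝ W] [FiniteDimensional ℝ W] [MeasurableSpace W] [BorelSpace W]
    [NormedAddCommGroup E] [NormedSpace ℝ E] [MeasureSpace E] [BorelSpace E]
    [NormedAddCommGroup F] [InnerProductSpace ℝ F] [FiniteDimensional ℝ F] [MeasurableSpace F]
    [BorelSpace F] (f : OpenPartialHomeomorph E F) (e : W ≃L[ℝ] E)
    (he : MeasurePreserving e volume volume) (hrank : finrank ℝ W = finrank ℝ F)
    (hf : ContDiffOn ℝ 1 f f.source) (hfinv : ContDiffOn ℝ 1 f.symm f.target)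
    {g : F → ℝ≥0∞} (hg : Measurable g) {H : E → ℝ≥0∞} (hH : Measurable H)
    (hHs : ∀ z ∈ f.source, H z = g (f z) * ENNReal.ofReal
      (fderiv ℝ f z ∘L e.toContinuousLinearMap).toLinearMap.normDet) :
    ∫⁻ z in f.target, g z = ∫⁻ z in f.source, H z := by
  have hs : IsOpen (e ⁻¹' f.source) := f.open_source.preimage e.continuous
  have hcd : ∀ y ∈ e ⁻¹' f.source, ContDiffAt ℝ 1 f (e y) := fun y hy =>
    hf.contDiffAt (f.open_source.mem_nhds hy)
  have hder : ∀ y ∈ e ⁻¹' f.source,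
      fderiv ℝ (f ∘ e) y = fderiv ℝ f (e y) ∘L e.toContinuousLinearMap :=
    fun y hy => (((hcd y hy).differentiableAt one_ne_zero).hasFDerivAt.comp y
      e.hasFDerivAt).fderiv
  have harea := setLIntegral_image_euclideanHausdorffMeasure (φ := f ∘ e) hs
    (fun y hy => (hcd y hy).comp y e.contDiff.contDiffAt)
    (f.injOn.comp e.injective.injOn fun y hy => hy)
    (fun y hy => by
      rw [hder y hy]
      exact (injective_fderiv_of_contDiffOn_symm f hf hfinv hy).comp e.injective) hg
  rw [image_comp, image_preimage_eq _ e.surjective, f.image_source_eq_target, hrank,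
    InnerProductSpace.euclideanHausdorffMeasure_eq_volume] at harea
  rw [harea, ← he.setLIntegral_comp_preimage f.open_source.measurableSet hH]
  refine setLIntegral_congr_fun hs.measurableSet fun y hy => ?_
  rw [hder y hy, hHs _ hy, Function.comp_apply]

/-- The product type carries the sup norm, so the Euclidean jacobian is reached through the
volume-preserving identification with the ℓ² product. `H` stands for the integrand, whose formula
need only hold on the source. -/
theorem setLIntegral_target (hk : k + m = n) (hf : ContDiffOn ℝ 1 f f.source)
    (hfinv : ContDiffOn ℝ 1 f.symm f.target) {g : EuclideanSpace ℝ (Fin n) → ℝ≥0∞}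
    (hg : Measurable g)
    {H : EuclideanSpace ℝ (Fin k) × EuclideanSpace ℝ (Fin m) → ℝ≥0∞} (hH : Measurable H)
    (hHs : ∀ z ∈ f.source, H z = g (f z) * ENNReal.ofReal (jac f z.1 z.2)) :
    ∫⁻ z in f.target, g z = ∫⁻ z in f.source, H z := by
  refine setLIntegral_target_of_measurePreserving f
    (WithLp.prodContinuousLinearEquiv 2 ℝ (EuclideanSpace ℝ (Fin k)) (EuclideanSpace ℝ (Fin m)))
    (WithLp.volume_preserving_ofLp _ _) ?_ hf hfinv hg hH hHs
  rw [(WithLp.prodContinuousLinearEquiv 2 ℝ (EuclideanSpace ℝ (Fin k))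
    (EuclideanSpace ℝ (Fin m))).toLinearEquiv.finrank_eq, finrank_prod, finrank_euclideanSpace_fin,
    finrank_euclideanSpace_fin, finrank_euclideanSpace_fin, hk]

/-- With w = |J^y_f| / |J_f| and J = |J_f|, the product w J = |J^y_f| is the area density on σ_x,
and J with Tonelli gives the volume of Ω. -/
theorem exists_isFibered (hk : k + m = n) (hU : IsOpen U) (hV : IsOpen V)
    (hsource : f.source = U ×ˢ V) (hf : ContDiffOn ℝ 1 f f.source)
    (hfinv : ContDiffOn ℝ 1 f.symm f.target) :
    ∃ φ w J, IsFibered (volume.restrict U) (volume.restrict V) (volume.restrict f.target) U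
      (fun x => (Measure.euclideanHausdorffMeasure m).restrict ((fun y => f (x, y)) '' V)) φ w J ∧
      ∀ z ∈ f.source, φ z = f z ∧ w z = ENNReal.ofReal (jacY f z.1 z.2 / jac f z.1 z.2) ∧
        J z = ENNReal.ofReal (jac f z.1 z.2) := by
  classical
  have hS := f.open_source.measurableSet
  have hmem : ∀ x ∈ U, ∀ y ∈ V, (x, y) ∈ f.source := fun x hx y hy => by
    rw [hsource]; exact ⟨hx, hy⟩
  -- Off U × V the values are irrelevant to the integrals; the value 1 for w and J keeps them
  -- positive and finite everywhere.
  set φ := f.source.piecewise f fun _ => 0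
  set w : _ × _ → ℝ≥0∞ := f.source.piecewise
    (fun z => ENNReal.ofReal (jacY f z.1 z.2 / jac f z.1 z.2)) fun _ => 1 with hw
  set J : _ × _ → ℝ≥0∞ := f.source.piecewise
    (fun z => ENNReal.ofReal (jac f z.1 z.2)) fun _ => 1 with hJ
  have hφm : Measurable φ := f.continuousOn.measurable_piecewise continuousOn_const hS
  have hwm : Measurable w := (ENNReal.continuous_ofReal.comp_continuousOn
    ((continuousOn_jacY hf).div (continuousOn_jac hf) fun z hz =>
      (jac_pos hf hfinv hz).ne')).measurable_piecewise continuousOn_const hS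
  have hJm : Measurable J := (ENNReal.continuous_ofReal.comp_continuousOn
    (continuousOn_jac hf)).measurable_piecewise continuousOn_const hS
  have hφs : ∀ z ∈ f.source, φ z = f z := fun z hz => piecewise_eq_of_mem _ _ _ hz
  have hws : ∀ z ∈ f.source, w z = ENNReal.ofReal (jacY f z.1 z.2 / jac f z.1 z.2) :=
    fun z hz => piecewise_eq_of_mem _ _ _ hz
  have hJs : ∀ z ∈ f.source, J z = ENNReal.ofReal (jac f z.1 z.2) :=
    fun z hz => piecewise_eq_of_mem _ _ _ hz
  refine ⟨φ, w, J, ⟨hφm, hwm, fun z => ?_, fun z => ?_, hJm, fun z => ?_, fun z => ?_,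
    ae_restrict_mem hU.measurableSet, fun x hx g hg => ?_, fun g hg => ?_, fun G hG => ?_⟩,
    fun z hz => ⟨hφs z hz, hws z hz, hJs z hz⟩⟩
  · by_cases hz : z ∈ f.source
    · rw [hws z hz]
      simpa using div_pos (jacY_pos hf hfinv hz) (jac_pos hf hfinv hz)
    · simp [hw, hz]
  · by_cases hz : z ∈ f.source
    · simp [hws z hz]
    · simp [hw, hz]
  · by_cases hz : z ∈ f.source
    · rw [hJs z hz]
      simpa using jac_pos hf hfinv hz
    · simp [hJ, hz]
  · by_cases hz : z ∈ f.source
    · simp [hJs z hz]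
    · simp [hJ, hz]
  · rw [setLIntegral_surface hf hfinv hV (hmem x hx) hg]
    refine setLIntegral_congr_fun hV.measurableSet fun y hy => ?_
    have hz := hmem x hx y hy
    have hj := jac_pos hf hfinv hz
    rw [hφs _ hz, hws _ hz, hJs _ hz, mul_assoc, ← ENNReal.ofReal_mul
      (div_nonneg (jacY_pos hf hfinv hz).le hj.le), div_mul_cancel₀ _ hj.ne']
  · have hH : Measurable fun z => g (φ z) * J z := (hg.comp hφm).mul hJm
    rw [setLIntegral_target hk hf hfinv hg hH fun z hz => by rw [hφs z hz, hJs z hz], hsource,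
      Measure.volume_eq_prod, ← Measure.prod_restrict, lintegral_prod _ hH.aemeasurable]
  · refine ⟨f.target.indicator (G ∘ f.symm),
      measurable_indicator_comp f.open_target f.symm.continuousOn hG, fun x hx => ?_⟩
    filter_upwards [ae_restrict_mem hV.measurableSet] with y hy
    have hz := hmem x hx y hy
    rw [hφs _ hz, indicator_of_mem (f.map_source hz), Function.comp_apply, f.left_inv hz]

end Diffeomorphism

end FugledeModulus

/-! ### The theorem, by identifying `ell` and `extremalFun` with their abstract counterparts. -/

open FugledeModulus in
theorem theorem1p3 (n m : ℕ) (hmn : m ≤ n) (p q : ℝ) (hpq : p.HolderConjugate q)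
    (U : Set (EuclideanSpace ℝ (Fin (n - m)))) (hU : IsOpen U) (hU' : IsConnected U)
    (V : Set (EuclideanSpace ℝ (Fin m))) (hV : IsOpen V) (hV' : IsConnected V)
    (Ω : Set (EuclideanSpace ℝ (Fin n)))
    -- `f` is a `C¹` diffeomorphism of `U × V` onto `Ω`
    (f : OpenPartialHomeomorph (EuclideanSpace ℝ (Fin (n - m)) × EuclideanSpace ℝ (Fin m))
      (EuclideanSpace ℝ (Fin n)))
    (hsource : f.source = U ×ˢ V) (htarget : f.target = Ω)
    (hf : ContDiffOn ℝ 1 f (U ×ˢ V)) (hfinv : ContDiffOn ℝ 1 f.symm Ω) :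
    -- the formula for the modulus
    modulus p (volume.restrict Ω) (surfaceFamily f U V)
        = ∫⁻ x in U, ell f V q x ^ (1 - p) ∧
    -- `f_Σ` is extremal when all the `l x` are finite
    ((∀ x ∈ U, ell f V q x ≠ ∞) →
      IsExtremal p (volume.restrict Ω) (surfaceFamily f U V) (extremalFun f V q)) ∧
    -- in general it is extremal up to the subfamily where `l x = ∞`, which has modulus zero
    (modulus p (volume.restrict Ω) (surfaceFamily f {x ∈ U | ell f V q x = ∞} V) = 0 ∧
      IsAdmissible (surfaceFamily f {x ∈ U | ell f V q x ≠ ∞} V) (extremalFun f V q) ∧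
      modulus p (volume.restrict Ω) (surfaceFamily f U V)
        = ∫⁻ z, extremalFun f V q z ^ p ∂(volume.restrict Ω)) ∧
    -- it is the only extremal function, up to null sets, when the modulus is finite
    (modulus p (volume.restrict Ω) (surfaceFamily f U V) ≠ ∞ →
      ∀ g : EuclideanSpace ℝ (Fin n) → ℝ≥0∞,
        IsExtremal p (volume.restrict Ω) (surfaceFamily f U V) g →
          g =ᵐ[volume.restrict Ω] extremalFun f V q) := by
  subst htarget
  rw [← hsource] at hf
  obtain ⟨φ, w, J, h, hφwJ⟩ := exists_isFibered (Nat.sub_add_cancel hmn) hU hV hsource hf hfinv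
  have hmem : ∀ x ∈ U, ∀ y ∈ V, (x, y) ∈ f.source := fun x hx y hy => by
    rw [hsource]; exact ⟨hx, hy⟩
  -- A nonzero measure on V guarantees l(x) ≠ 0, so that 1/l(x) is finite.
  have : NeZero ((volume : Measure (EuclideanSpace ℝ (Fin m))).restrict V) :=
    ⟨fun h0 => (hV.measure_pos volume hV'.nonempty).ne' (Measure.restrict_eq_zero.1 h0)⟩
  have hell : ∀ x ∈ U, ell f V q x = fiberWeight (volume.restrict V) w J q x := fun x hx => by
    refine setLIntegral_congr_fun hV.measurableSet fun y hy => ?_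
    have hz := hmem x hx y hy
    have hd := div_pos (jacY_pos hf hfinv hz) (jac_pos hf hfinv hz)
    obtain ⟨-, hw, hJ⟩ := hφwJ _ hz
    rw [hw, hJ, ENNReal.ofReal_rpow_of_pos hd, ENNReal.ofReal_mul (Real.rpow_nonneg hd.le q)]
  have hext : extremalFun f V q = f.target.indicator
      ((fun z => (fiberWeight (volume.restrict V) w J q z.1)⁻¹ * w z ^ (q - 1)) ∘ f.symm) := by
    refine indicator_congr fun z hz => ?_
    have hs := f.map_target hz
    have hd := div_pos (jacY_pos hf hfinv hs) (jac_pos hf hfinv hs)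
    rw [Function.comp_apply, (hφwJ _ hs).2.1, ENNReal.ofReal_rpow_of_pos hd,
      hell _ (by rw [hsource] at hs; exact hs.1)]
  have hfm : Measurable (extremalFun f V q) := by
    rw [hext]
    exact measurable_indicator_comp f.open_target f.symm.continuousOn
      (((h.measurable_fiberWeight q).comp measurable_fst).inv.mul
        (h.measurable_weight.pow_const _))
  have hfφ : ∀ x ∈ U, ∀ᵐ y ∂volume.restrict V, extremalFun f V q (φ (x, y)) =
      (fiberWeight (volume.restrict V) w J q x)⁻¹ * w (x, y) ^ (q - 1) := fun x hx => by
    filter_upwards [ae_restrict_mem hV.measurableSet] with y hy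
    have hz := hmem x hx y hy
    rw [hext, (hφwJ _ hz).1, indicator_of_mem (f.map_source hz), Function.comp_apply, f.left_inv hz]
  have hint : ∫⁻ x in U, ell f V q x ^ (1 - p) =
      ∫⁻ x in U, fiberWeight (volume.restrict V) w J q x ^ (1 - p) :=
    setLIntegral_congr_fun hU.measurableSet fun x hx => by simp only [hell x hx]
  have htop : {x ∈ U | ell f V q x = ∞} =
      {x ∈ U | fiberWeight (volume.restrict V) w J q x = ∞} :=
    Set.ext fun x => and_congr_right fun hx => by rw [hell x hx]
  have hntop : {x ∈ U | ell f V q x ≠ ∞} =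
      {x ∈ U | fiberWeight (volume.restrict V) w J q x ≠ ∞} :=
    Set.ext fun x => and_congr_right fun hx => by rw [hell x hx]
  have hmod := h.modulus_eq hpq hfm hfφ
  have hadm := h.isAdmissible_of_ne_top hfm hfφ
  have henergy := h.lintegral_rpow_eq hpq hfm hfφ
  refine ⟨hmod.trans hint.symm, fun hfin => ⟨?_, hmod.trans henergy.symm⟩,
    ⟨?_, ?_, hmod.trans henergy.symm⟩, fun hfin g hg => h.ae_eq_of_isExtremal hpq hfm hfφ hfin hg⟩
  · rw [← hntop, sep_eq_self_iff_mem_true.2 hfin] at hadm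
    exact hadm
  · rw [htop]
    exact h.modulus_eq_zero_of_eq_top hpq
  · rw [hntop]
    exact hadm
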